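/- Let $n\ge 3$. Let $(W,S)$ be a Coxeter system of type $D_n$ with $S=\{s_1,\dots,s_n\}$, numbered so that the edges of the Coxeter graph (all with label $3$) are $s_1 - s_3$ and $s_i - s_{i+1}$ for $2\le i\le n-1$. Let $(W',S')$ be a Coxeter system of type $A_{n-1}$ with $S'=\{s'_1,\dots,s'_{n-1}\}$, numbered so that the edges (all with label $3$) are $s'_i - s'_{i+1}$ for $1\le i\le n-2$. For a finite Coxeter system $(V,T)$ with length function $\ell$ and $J\subseteq T$, put $X_J=\{w\in V : \ell(ws)>\ell(w) \text{ for all } s\in J\}$ and $x_J=\sum_{w\in X_J}w\in\mathbb{Q}V$. In $\mathbb{Q}W$ put $x_1^D=x_\emptyset$ and $x_j^D=x_{\{s_1,\dots,s_j\}}$ for $2\le j\le n$. In $\mathbb{Q}W'$ put $x_j^A=x_{\{s'_1,\dots,s'_j\}}$ for $0\le j\le n-1$ (so $x_0^A=x_\emptyset$). Let $\mathfrak{E}(W)=\mathbb{Q}[x_{n-1}^D]\subseteq\mathbb{Q}W$ and $\mathfrak{E}(W')=\mathbb{Q}[x_{n-2}^A]\subseteq\mathbb{Q}W'$ be the unital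 $\mathbb{Q}$-subalgebras generated by these elements. Then $x_j^D\in\mathfrak{E}(W)$ and $x_{j-1}^A\in\mathfrak{E}(W')$ for $1\le j\le n$, and there is a $\mathbb{Q}$-algebra isomorphism $\varphi:\mathfrak{E}(W)\to\mathfrak{E}(W')$ with $$\varphi(x_j^D)=2^{\,n-j}\,x_{j-1}^A\qquad\text{for all } 1\le j\le n.$$ -/

import Mathlib

/-- The Coxeter matrix of type `D_n`, where the index `i : Fin n` stands for the generator
`s_{i+1}`. The edges of the Coxeter graph, all of label `3`, are `s_1 - s_3`
and `s_i - s_{i+1}` for `2 ≤ i ≤ n - 1`. -/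
def coxeterMatrixD (n : ℕ) : CoxeterMatrix (Fin n) where
  M := Matrix.of fun i j : Fin n ↦
    if i = j then 1
    else if ((i : ℕ) = 0 ∧ (j : ℕ) = 2) ∨ ((j : ℕ) = 0 ∧ (i : ℕ) = 2) ∨
        (1 ≤ (i : ℕ) ∧ (i : ℕ) + 1 = j) ∨ (1 ≤ (j : ℕ) ∧ (j : ℕ) + 1 = i) then 3
    else 2
  isSymm := by
    ext i j
    simp only [Matrix.transpose_apply, Matrix.of_apply]
    grind
  diagonal := by simp
  off_diagonal := by
    intro i j h
    simp only [Matrix.of_apply]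
    grind

section

variable {B W : Type*} [Group W] {M : CoxeterMatrix B}

/-- `X_J = {w ∈ W : ℓ(ws) > ℓ(w) for all s ∈ J}`. -/
def minCosetReps (cs : CoxeterSystem M W) (J : Set B) : Set W :=
  {w | ∀ i ∈ J, cs.length w < cs.length (w * cs.simple i)}

/-- The standard basis element `x_J = ∑_{w ∈ X_J} w` of the descent algebra, as an element of the
group algebra `ℚ W` (for finite `W`). -/
noncomputable def descentElement (cs : CoxeterSystem M W) (J : Set B) : MonoidAlgebra ℚ W :=
  ∑ᶠ w ∈ minCosetReps cs J, MonoidAlgebra.of ℚ W w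

end

/-- The set `{s_1, …, s_j}` in a system with generators `s_1, …, s_n`; the index `i : Fin n`
stands for `s_{i+1}`. -/
def initialSegment (n j : ℕ) : Set (Fin n) := {i | (i : ℕ) < j}

section

variable {n : ℕ} {W : Type*} [Group W]

/-- In type `A_n`: `x_j = x_{{s_1, …, s_j}}` for `0 ≤ j ≤ n`. -/
noncomputable def xA (cs : CoxeterSystem (CoxeterMatrix.A n) W) (j : ℕ) : MonoidAlgebra ℚ W :=
  descentElement cs (initialSegment n j)

/-- In type `D_n`: `x_j = x_{{s_1, …, s_j}}` for `2 ≤ j ≤ n`, and `x_1 = x_∅`. -/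
noncomputable def xD (cs : CoxeterSystem (coxeterMatrixD n) W) (j : ℕ) : MonoidAlgebra ℚ W :=
  if j ≤ 1 then descentElement cs ∅ else descentElement cs (initialSegment n j)

/-- `𝔈(W) = ℚ[x_{n-1}]` for `W` of type `A_n`, as a subalgebra of `ℚ W`. -/
noncomputable def algEA (cs : CoxeterSystem (CoxeterMatrix.A n) W) :
    Subalgebra ℚ (MonoidAlgebra ℚ W) :=
  Algebra.adjoin ℚ {xA cs (n - 1)}

/-- `𝔈(W) = ℚ[x_{n-1}]` for `W` of type `D_n`, as a subalgebra of `ℚ W`. -/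
noncomputable def algED (cs : CoxeterSystem (coxeterMatrixD n) W) :
    Subalgebra ℚ (MonoidAlgebra ℚ W) :=
  Algebra.adjoin ℚ {xD cs (n - 1)}

end

/-! ### Geometric representation and the sign of roots. -/

section GeometricRepresentation

variable {B : Type*} [Fintype B] [DecidableEq B]

/-! Left multiplication by the generator is triangular. In type D_n, x_{n-1} x_j = 2(n-j) x_j +
x_{j-1} for j ≥ 2 and x_{n-1} x_1 = 2n x_1 (`xD_mul_xD`, `xD_mul_xD_one`). In type A_{n-1}, x_{n-2}
x_{j-1} = (n-j) x_{j-1} + x_{j-2} for j ≥ 2 and x_{n-2} x_0 = n x_0 (`xA_mul_xA`, `xA_mul_xA_zero`).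
Hence x_{n-t}^D under x_{n-1}^D, and 2^t x_{n-1-t}^A under 2 x_{n-2}^A, obey one recursion with the
same eigenvalues. Both families are linearly independent, so the two generators have the same
annihilating polynomials, and `IsNewtonChain.exists_algEquiv` matches the families term by term.

The formulas come from `descentElement_mul_descentElement`: x_{S∖{m}} x_K is the sum of x_{K ∩ λ^⊥}
over the weights λ in the orbit of the fundamental weight ω_m that are nonnegative on the simple
roots of K. It rests on the fact that ℓ(w s_i) > ℓ(w) exactly when w α_i ≥ 0. For the last m, the
orbit consists of the ε_a in type A and of the ±ε_a in type D; the two signs account for the factor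
2. -/

/-- The entries of the Cartan matrix attached to a simply laced Coxeter matrix. -/
def CoxeterMatrix.cartanEntry (M : CoxeterMatrix B) (i j : B) : ℤ :=
  if i = j then 2 else if M i j = 3 then -1 else 0

/-- The pairing of a vector, written in the basis of simple roots, with the `i`-th coroot. -/
def CoxeterMatrix.coroot (M : CoxeterMatrix B) (i : B) : (B → ℤ) →ₗ[ℤ] ℤ :=
  ∑ k, M.cartanEntry i k • LinearMap.proj k

/-- The `i`-th simple reflection on the root lattice of a simply laced Coxeter matrix. -/
def CoxeterMatrix.reflect (M : CoxeterMatrix B) (i : B) : Module.End ℤ (B → ℤ) :=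
  LinearMap.id - (M.coroot i).smulRight (Pi.single i 1)

/-- A Coxeter matrix is simply laced if its off-diagonal entries are `2` or `3`. -/
def CoxeterMatrix.IsSimplyLaced (M : CoxeterMatrix B) : Prop :=
  ∀ i j, i ≠ j → M i j = 2 ∨ M i j = 3

variable {M : CoxeterMatrix B}

theorem CoxeterMatrix.coroot_single (i j : B) :
    M.coroot i (Pi.single j 1) = M.cartanEntry i j := by
  simp [CoxeterMatrix.coroot, Pi.single_apply]

theorem CoxeterMatrix.reflect_apply (i : B) (v : B → ℤ) :
    M.reflect i v = v - M.coroot i v • Pi.single i (1 : ℤ) := by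
  simp [CoxeterMatrix.reflect]

theorem CoxeterMatrix.coroot_reflect (i j : B) (v : B → ℤ) :
    M.coroot j (M.reflect i v) = M.coroot j v - M.coroot i v * M.cartanEntry j i := by
  simp only [reflect_apply, map_sub, map_smul, coroot_single, smul_eq_mul]

theorem CoxeterMatrix.IsSimplyLaced.isLiftable (hM : M.IsSimplyLaced) :
    M.IsLiftable M.reflect := by
  intro i j
  by_cases hij : i = j
  · subst hij
    simp only [M.diagonal, pow_one]
    refine LinearMap.ext fun v ↦ ?_
    simp only [Module.End.mul_apply, Module.End.one_apply]
    rw [M.reflect_apply i (M.reflect i v), M.coroot_reflect, M.reflect_apply]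
    simp only [cartanEntry, if_true]
    module
  · have hs : M j i = M i j := M.symmetric j i
    refine LinearMap.ext fun v ↦ ?_
    rcases hM i j hij with h | h
    · rw [h, pow_two]
      have c1 : M.cartanEntry i j = 0 := by simp [cartanEntry, hij, h]
      have c2 : M.cartanEntry j i = 0 := by simp [cartanEntry, Ne.symm hij, hs, h]
      have c3 : M.cartanEntry i i = 2 := by simp [cartanEntry]
      have c4 : M.cartanEntry j j = 2 := by simp [cartanEntry]
      simp only [Module.End.mul_apply, Module.End.one_apply, reflect_apply, map_sub, map_smul,
        coroot_single, c1, c2, c3, c4]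
      module
    · rw [h, pow_three]
      have c1 : M.cartanEntry i j = -1 := by simp [cartanEntry, hij, h]
      have c2 : M.cartanEntry j i = -1 := by simp [cartanEntry, Ne.symm hij, hs, h]
      have c3 : M.cartanEntry i i = 2 := by simp [cartanEntry]
      have c4 : M.cartanEntry j j = 2 := by simp [cartanEntry]
      simp only [Module.End.mul_apply, Module.End.one_apply, reflect_apply, map_sub, map_smul,
        coroot_single, c1, c2, c3, c4]
      module

variable {W : Type*} [Group W]

/-- The geometric representation of a simply laced Coxeter group on its root lattice. -/
noncomputable def CoxeterSystem.geomRep (cs : CoxeterSystem M W) (hM : M.IsSimplyLaced) :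
    W →* Module.End ℤ (B → ℤ) :=
  cs.lift ⟨M.reflect, hM.isLiftable⟩

/-- The root `w α_i`, written in the basis of simple roots. -/
noncomputable def CoxeterSystem.root (cs : CoxeterSystem M W) (hM : M.IsSimplyLaced) (w : W)
    (i : B) : B → ℤ :=
  cs.geomRep hM w (Pi.single i 1)

namespace CoxeterSystem

variable (cs : CoxeterSystem M W) (hM : M.IsSimplyLaced)

theorem geomRep_mul_apply (w w' : W) (v : B → ℤ) :
    cs.geomRep hM (w * w') v = cs.geomRep hM w (cs.geomRep hM w' v) := by
  rw [map_mul, Module.End.mul_apply]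

theorem geomRep_inv_apply_self (w : W) (v : B → ℤ) :
    cs.geomRep hM w⁻¹ (cs.geomRep hM w v) = v := by
  rw [← geomRep_mul_apply, inv_mul_cancel, map_one, Module.End.one_apply]

theorem geomRep_simple_single (i j : B) :
    cs.geomRep hM (cs.simple i) (Pi.single j 1) =
      Pi.single j 1 - M.cartanEntry i j • Pi.single i (1 : ℤ) := by
  rw [geomRep, cs.lift_apply_simple, M.reflect_apply, M.coroot_single]

theorem root_mul_simple (w : W) (i j : B) :
    cs.root hM (w * cs.simple i) j = cs.root hM w j - M.cartanEntry i j • cs.root hM w i := by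
  rw [root, geomRep_mul_apply, geomRep_simple_single, map_sub, map_smul]; rfl

theorem root_mul_simple_self (w : W) (i : B) :
    cs.root hM (w * cs.simple i) i = -cs.root hM w i := by
  rw [root_mul_simple, CoxeterMatrix.cartanEntry, if_pos rfl]; module

theorem geomRep_apply_eq_sum (w : W) (v : B → ℤ) :
    cs.geomRep hM w v = ∑ k, v k • cs.root hM w k := by
  conv_lhs => rw [pi_eq_sum_univ' v]
  simp only [map_sum, map_smul, root]

theorem root_ne_zero (w : W) (i : B) : cs.root hM w i ≠ 0 := by
  intro h
  have h1 := cs.geomRep_inv_apply_self hM w (Pi.single i 1)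
  rw [show cs.geomRep hM w (Pi.single i 1) = 0 from h, map_zero] at h1
  simpa using congrFun h1 i

/-- If `ℓ(w s_i) > ℓ(w)` then `w α_i` is a nonnegative combination of simple roots. -/
theorem root_nonneg_of_length_lt (w : W) (i : B)
    (h : cs.length w < cs.length (w * cs.simple i)) : 0 ≤ cs.root hM w i := by
  induction hl : cs.length w using Nat.strong_induction_on generalizing w i with
  | _ l ih =>
  subst hl
  by_cases hw : w = 1
  · subst hw
    rw [root, map_one, Module.End.one_apply]
    exact Pi.single_nonneg.2 zero_le_one
  obtain ⟨t, ht⟩ := cs.exists_rightDescent_of_ne_one hw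
  unfold IsRightDescent at ht
  -- Since w α_i = v (s_t α_i), the claim reduces to roots of the shorter element v in the rank two
  -- system of t and i.
  set v := w * cs.simple t with hv
  have hwv : w = v * cs.simple t := by simp [hv]
  have hti : i ≠ t := by rintro rfl; exact absurd h (not_lt.2 ht.le)
  have hvt : 0 ≤ cs.root hM v t := ih _ ht v t (by rw [← hwv]; exact ht) rfl
  have hlw : cs.length w = cs.length v + 1 := by
    have h1 := cs.length_mul_simple w t
    rw [← hv] at h1
    omega
  have hlwi : cs.length (w * cs.simple i) = cs.length v + 2 := by
    have h1 := cs.length_mul_simple w i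
    omega
  rw [hwv, root_mul_simple]
  rcases hM t i (Ne.symm hti) with h2 | h3
  · have hcomm : cs.simple t * cs.simple i = cs.simple i * cs.simple t := by
      have := cs.simple_mul_simple_pow t i
      rw [h2, pow_two] at this
      simpa using (inv_eq_iff_mul_eq_one.2 this).symm
    have hvi : 0 ≤ cs.root hM v i := by
      refine ih _ ht v i ?_ rfl
      have h4 := cs.length_mul_simple (v * cs.simple i) t
      rw [mul_assoc, ← hcomm, ← mul_assoc, ← hwv] at h4
      omega
    simpa [CoxeterMatrix.cartanEntry, Ne.symm hti, h2] using hvi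
  · have hc : M.cartanEntry t i = -1 := by simp [CoxeterMatrix.cartanEntry, Ne.symm hti, h3]
    have hc' : M.cartanEntry i t = -1 := by
      simp [CoxeterMatrix.cartanEntry, hti, M.symmetric i t, h3]
    rw [hc, neg_one_smul, sub_neg_eq_add]
    rcases cs.length_mul_simple v i with h4 | h4
    · exact add_nonneg (ih _ ht v i (by omega) rfl) hvt
    -- Here v α_i is negative, but w α_i = v(α_i + α_t) = u α_t. The braid relation gives w s_i = u
    -- s_t s_i s_t, of length ℓ(u) + 3, which forces ℓ(u s_t) > ℓ(u).
    · set u := v * cs.simple i with hu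
      have hvu : v = u * cs.simple i := by simp [hu]
      have hbraid : cs.simple t * cs.simple i * cs.simple t =
          cs.simple i * cs.simple t * cs.simple i := by
        have := cs.simple_mul_simple_pow t i
        rw [h3, pow_three] at this
        have h5 : (cs.simple t * cs.simple i * cs.simple t) *
            (cs.simple i * cs.simple t * cs.simple i) = 1 := by simpa [mul_assoc] using this
        simpa [mul_assoc] using inv_eq_iff_mul_eq_one.2 h5
      have hut : cs.length u < cs.length (u * cs.simple t) := by
        have h6 : w * cs.simple i = u * cs.simple t * cs.simple i * cs.simple t := by
          rw [hwv, hvu]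
          simp only [mul_assoc] at hbraid ⊢
          rw [hbraid]
        have h7 := cs.length_mul_simple (u * cs.simple t) i
        have h8 := cs.length_mul_simple (u * cs.simple t * cs.simple i) t
        rw [← h6] at h8
        rcases h7 with h7 | h7 <;> rcases h8 with h8 | h8 <;> omega
      have h9 : 0 ≤ cs.root hM u t := ih _ (by omega) u t hut rfl
      have h10 : cs.root hM v i + cs.root hM v t = cs.root hM u t := by
        rw [hvu, root_mul_simple_self, root_mul_simple cs hM u i t, hc']
        module
      rwa [h10]

theorem length_lt_iff_root_nonneg (w : W) (i : B) :
    cs.length w < cs.length (w * cs.simple i) ↔ 0 ≤ cs.root hM w i := by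
  refine ⟨cs.root_nonneg_of_length_lt hM w i, fun h ↦ ?_⟩
  by_contra hlt
  have h1 : cs.length (w * cs.simple i) < cs.length (w * cs.simple i * cs.simple i) := by
    rw [cs.simple_mul_simple_cancel_right]
    exact lt_of_le_of_ne (not_lt.1 hlt) (cs.length_mul_simple_ne w i)
  have h2 := cs.root_nonneg_of_length_lt hM _ i h1
  rw [root_mul_simple_self] at h2
  exact cs.root_ne_zero hM w i (le_antisymm (neg_nonneg.1 h2) h)

theorem root_nonneg_or_nonpos (w : W) (i : B) :
    0 ≤ cs.root hM w i ∨ cs.root hM w i ≤ 0 := by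
  by_cases h : cs.length w < cs.length (w * cs.simple i)
  · exact Or.inl (cs.root_nonneg_of_length_lt hM w i h)
  · right
    have h1 : cs.length (w * cs.simple i) < cs.length (w * cs.simple i * cs.simple i) := by
      rw [cs.simple_mul_simple_cancel_right]
      exact lt_of_le_of_ne (not_lt.1 h) (cs.length_mul_simple_ne w i)
    have h2 := cs.root_nonneg_of_length_lt hM _ i h1
    rw [root_mul_simple_self] at h2
    exact neg_nonneg.1 h2

theorem mem_minCosetReps_iff {w : W} {K : Set B} :
    w ∈ minCosetReps cs K ↔ ∀ k ∈ K, 0 ≤ cs.root hM w k := by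
  simp only [minCosetReps, Set.mem_ofPred_eq, cs.length_lt_iff_root_nonneg hM]

theorem eq_one_of_root_nonneg {w : W} (h : ∀ i, 0 ≤ cs.root hM w i) : w = 1 := by
  by_contra hw
  obtain ⟨i, hi⟩ := cs.exists_rightDescent_of_ne_one hw
  exact absurd ((cs.length_lt_iff_root_nonneg hM w i).2 (h i)) (not_lt.2 hi.le)

theorem geomRep_injective : Function.Injective (cs.geomRep hM) := by
  rw [injective_iff_map_eq_one]
  intro w hw
  refine cs.eq_one_of_root_nonneg hM fun i ↦ ?_
  rw [root, hw, Module.End.one_apply]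
  exact Pi.single_nonneg.2 zero_le_one

end CoxeterSystem

end GeometricRepresentation

-- `finsum` returns `0` on an infinite support, so finiteness is essential here; it is derived from
-- the orbit of a weight in `finite_of_range_weightRow_eq`.
open scoped Classical in
theorem coeff_descentElement {B W : Type*} [Group W] [Finite W] {M : CoxeterMatrix B}
    (cs : CoxeterSystem M W) (K : Set B) (w : W) :
    (descentElement cs K).coeff w = if w ∈ minCosetReps cs K then 1 else 0 := by
  rw [descentElement, finsum_mem_eq_finite_toFinset_sum _ (Set.toFinite _),
    MonoidAlgebra.coeff_sum, Finsupp.finsetSum_apply]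
  simp [MonoidAlgebra.of_apply, Finsupp.single_apply]

/-! ### Minimal coset representatives and the orbit of a fundamental weight. -/

section DescentProduct

variable {B : Type*} [Fintype B] [DecidableEq B] {M : CoxeterMatrix B} {W : Type*} [Group W]

namespace CoxeterSystem

variable (cs : CoxeterSystem M W) (hM : M.IsSimplyLaced) (m : B)

/-- The `m`-th row of the matrix of `w` in the geometric representation: the values on the simple
roots of the image under `w⁻¹` of the `m`-th fundamental weight. -/
noncomputable def weightRow (w : W) (k : B) : ℤ := cs.root hM w k m

theorem weightRow_one : cs.weightRow hM m 1 = Pi.single m 1 := by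
  ext k
  simp [weightRow, root, Pi.single_apply, eq_comm]

theorem weightRow_mul_simple (w : W) (i k : B) :
    cs.weightRow hM m (w * cs.simple i) k =
      cs.weightRow hM m w k - M.cartanEntry i k * cs.weightRow hM m w i := by
  simp only [weightRow, root_mul_simple, Pi.sub_apply, Pi.smul_apply, smul_eq_mul]

theorem geomRep_apply_eq_dotProduct (w : W) (v : B → ℤ) :
    cs.geomRep hM w v m = ∑ k, v k * cs.weightRow hM m w k := by
  rw [geomRep_apply_eq_sum, Finset.sum_apply]
  rfl

theorem weightRow_mul (w w' : W) (k : B) :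
    cs.weightRow hM m (w * w') k = ∑ j, cs.root hM w' k j * cs.weightRow hM m w j := by
  rw [weightRow, root, geomRep_mul_apply, geomRep_apply_eq_dotProduct]
  rfl

/-- The group acts on rows from the right, so the row of a product depends on its left factor only
through that factor's row. -/
theorem weightRow_mul_congr {y y' : W} (h : cs.weightRow hM m y = cs.weightRow hM m y') (w : W) :
    cs.weightRow hM m (y * w) = cs.weightRow hM m (y' * w) := by
  ext k
  rw [weightRow_mul, weightRow_mul, h]

variable {m} {u : W} (hu : u ∈ minCosetReps cs {m}ᶜ)

include hu

theorem geomRep_nonneg_of_mem_minCosetReps {v : B → ℤ} (hv : 0 ≤ v) (hvm : v m = 0) :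
    0 ≤ cs.geomRep hM u v := by
  rw [geomRep_apply_eq_sum]
  refine Finset.sum_nonneg fun k _ ↦ ?_
  by_cases hk : k = m
  · subst hk; simp [hvm]
  · exact smul_nonneg (hv k) ((cs.mem_minCosetReps_iff hM).1 hu k hk)

/-- A nonzero coefficient at α_m decides the sign of a root. If it is zero, the root lies in the
span of the other simple roots, where u preserves signs. -/
theorem root_inv_mul_nonneg_iff (w : W) (k : B) :
    0 ≤ cs.root hM (u⁻¹ * w) k ↔ 0 < cs.weightRow hM m (u⁻¹ * w) k ∨
      (cs.weightRow hM m (u⁻¹ * w) k = 0 ∧ 0 ≤ cs.root hM w k) := by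
  have huw : cs.geomRep hM u (cs.root hM (u⁻¹ * w) k) = cs.root hM w k := by
    rw [root, ← geomRep_mul_apply, mul_inv_cancel_left]; rfl
  constructor
  · intro h
    rcases (h m).lt_or_eq with h1 | h1
    · exact Or.inl h1
    · exact Or.inr ⟨h1.symm, huw ▸ cs.geomRep_nonneg_of_mem_minCosetReps hM hu h h1.symm⟩
  · rintro (h | ⟨h0, h⟩)
    · rcases cs.root_nonneg_or_nonpos hM (u⁻¹ * w) k with h1 | h1
      · exact h1
      · exact absurd (h1 m) (not_le.2 h)
    · rcases cs.root_nonneg_or_nonpos hM (u⁻¹ * w) k with h1 | h1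
      · exact h1
      · have h2 := cs.geomRep_nonneg_of_mem_minCosetReps hM hu (neg_nonneg.2 h1)
          (by rw [Pi.neg_apply, neg_eq_zero]; exact h0)
        rw [map_neg, huw] at h2
        exact absurd (le_antisymm (neg_nonneg.1 h2) h) (cs.root_ne_zero hM w k)

/-- Equality of rows means that u⁻¹u' fixes ω_m. The sign criterion then makes all its roots
nonnegative, so it has no descent and is trivial. -/
theorem eq_of_weightRow_inv_eq {u' : W} (hu' : u' ∈ minCosetReps cs {m}ᶜ)
    (h : cs.weightRow hM m u⁻¹ = cs.weightRow hM m u'⁻¹) : u = u' := by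
  have h1 : cs.weightRow hM m (u⁻¹ * u') = Pi.single m 1 := by
    rw [cs.weightRow_mul_congr hM m h, inv_mul_cancel, weightRow_one]
  rw [← inv_mul_eq_one]
  refine cs.eq_one_of_root_nonneg hM fun k ↦ (cs.root_inv_mul_nonneg_iff hM hu u' k).2 ?_
  rw [h1]
  by_cases hk : k = m
  · subst hk; simp
  · exact Or.inr ⟨by simp [hk], (cs.mem_minCosetReps_iff hM).1 hu' k hk⟩

omit hu

/-- Stripping right descents s_i with i ≠ m shortens z and leaves z ω_m unchanged, because s_i fixes
ω_m. -/
theorem exists_mem_minCosetReps_weightRow_inv_eq (m : B) (z : W) :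
    ∃ u ∈ minCosetReps cs {m}ᶜ, cs.weightRow hM m u⁻¹ = cs.weightRow hM m z⁻¹ := by
  induction hl : cs.length z using Nat.strong_induction_on generalizing z with
  | _ l ih =>
  subst hl
  by_cases hz : z ∈ minCosetReps cs {m}ᶜ
  · exact ⟨z, hz, rfl⟩
  simp only [minCosetReps, Set.mem_ofPred_eq, not_forall, not_lt] at hz
  obtain ⟨i, hi, hlt⟩ := hz
  obtain ⟨u, hu, h⟩ := ih _ (lt_of_le_of_ne hlt (cs.length_mul_simple_ne z i)) _ rfl
  refine ⟨u, hu, h.trans ?_⟩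
  rw [mul_inv_rev, cs.inv_simple, ← one_mul z⁻¹, ← mul_assoc]
  refine cs.weightRow_mul_congr hM m ?_ _
  ext k
  have hi' : i ≠ m := hi
  rw [mul_one, ← one_mul (cs.simple i), weightRow_mul_simple, weightRow_one]
  simp [hi']

end CoxeterSystem

end DescentProduct

/-! ### Finiteness and the product formula. -/

section WeightOrbit

variable {B : Type*} [Fintype B] [DecidableEq B] {M : CoxeterMatrix B} {W : Type*} [Group W]

namespace CoxeterSystem

variable (cs : CoxeterSystem M W) (hM : M.IsSimplyLaced) {m : B} {ι : Type*}
  {q : ι → B → ℤ}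

/-- A simply laced Coxeter group is finite if the orbit of one fundamental weight is finite and
separates the points of the root lattice. -/
theorem finite_of_range_weightRow_eq [Finite ι] (hq : Set.range (cs.weightRow hM m) = Set.range q)
    (hsep : ∀ v : B → ℤ, (∀ a, ∑ k, v k * q a k = 0) → v = 0) : Finite W := by
  have hex : ∀ a, ∃ y, cs.weightRow hM m y = q a := fun a ↦
    (Set.ext_iff.1 hq (q a)).2 ⟨a, rfl⟩
  choose y hy using hex
  -- Each element is recorded by its right action on the finite orbit; the action is faithful since
  -- the orbit separates lattice points.
  let f : W → ι → Set.range q := fun w a ↦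
    ⟨cs.weightRow hM m (y a * w), hq ▸ Set.mem_range_self _⟩
  refine Finite.of_injective f fun w w' h ↦ cs.geomRep_injective hM (LinearMap.ext fun v ↦ ?_)
  rw [← sub_eq_zero]
  refine hsep _ fun a ↦ ?_
  have h1 : cs.weightRow hM m (y a * w) = cs.weightRow hM m (y a * w') :=
    congrArg Subtype.val (congrFun h a)
  rw [← hy a, ← geomRep_apply_eq_dotProduct, map_sub, Pi.sub_apply, ← geomRep_mul_apply,
    ← geomRep_mul_apply, geomRep_apply_eq_dotProduct, geomRep_apply_eq_dotProduct, h1, sub_self]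

/-- The product of `x_J`, for `J` the complement of `m`, and `x_K` is a sum over the orbit of the
`m`-th fundamental weight. -/
theorem descentElement_mul_descentElement [Finite W] (hinj : Function.Injective q)
    (hq : Set.range (cs.weightRow hM m) = Set.range q) {K : Set B} {s : Finset ι}
    (hs : ∀ a, a ∈ s ↔ ∀ k ∈ K, 0 ≤ q a k) :
    descentElement cs {m}ᶜ * descentElement cs K =
      ∑ a ∈ s, descentElement cs {k ∈ K | q a k = 0} := by
  classical
  have := Fintype.ofFinite W
  ext w
  rw [MonoidAlgebra.coeff_mul_apply_left, Finsupp.sum_fintype _ _ (by simp),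
    MonoidAlgebra.coeff_sum, Finsupp.finsetSum_apply]
  simp only [coeff_descentElement, ite_mul, one_mul, zero_mul]
  simp only [← ite_and]
  rw [Finset.sum_boole, Finset.sum_boole]
  congr 1
  have hex : ∀ u : W, ∃ a, q a = cs.weightRow hM m (u⁻¹ * w) := fun u ↦
    (Set.ext_iff.1 hq (cs.weightRow hM m (u⁻¹ * w))).1 ⟨_, rfl⟩
  choose f hf using hex
  -- The left coefficient at w counts the u in X_{S∖{m}} with u⁻¹w in X_K. Such a u is sent to the
  -- weight w⁻¹u ω_m, and the sign criterion splits the condition into nonnegativity on K and w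
  -- lying in X for the zero set.
  refine Finset.card_bij (fun u _ ↦ f u) ?_ ?_ ?_
  · intro u hu
    simp only [Finset.mem_filter, Finset.mem_univ, true_and, hs] at hu ⊢
    obtain ⟨hu, huw⟩ := hu
    rw [mem_minCosetReps_iff cs hM] at huw
    simp only [mem_minCosetReps_iff cs hM, Set.mem_ofPred_eq, hf]
    refine ⟨fun k hk ↦ ?_, fun k hk ↦ ?_⟩
    · exact huw k hk m
    · rcases (cs.root_inv_mul_nonneg_iff hM hu w k).1 (huw k hk.1) with h | h
      · exact absurd hk.2 h.ne'
      · exact h.2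
  · intro u hu u' hu' h
    simp only [Finset.mem_filter, Finset.mem_univ, true_and] at hu hu'
    refine cs.eq_of_weightRow_inv_eq hM hu.1 hu'.1 ?_
    have h1 : cs.weightRow hM m (u⁻¹ * w) = cs.weightRow hM m (u'⁻¹ * w) := by
      rw [← hf, ← hf, h]
    simpa using cs.weightRow_mul_congr hM m h1 w⁻¹
  · intro a ha
    simp only [Finset.mem_filter, mem_minCosetReps_iff cs hM, hs, Set.mem_ofPred_eq] at ha
    obtain ⟨y, hy⟩ := (Set.ext_iff.1 hq (q a)).2 ⟨a, rfl⟩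
    -- The required u is the minimal representative of the coset of w y⁻¹, as then u⁻¹w has the row
    -- of y.
    obtain ⟨u, hu, huy⟩ := cs.exists_mem_minCosetReps_weightRow_inv_eq hM m (w * y⁻¹)
    have h1 : cs.weightRow hM m (u⁻¹ * w) = q a := by
      rw [cs.weightRow_mul_congr hM m huy, ← hy]
      congr 1
      group
    refine ⟨u, ?_, hinj ((hf u).trans h1)⟩
    simp only [Finset.mem_filter, Finset.mem_univ, true_and]
    refine ⟨hu, (cs.mem_minCosetReps_iff hM).2 fun k hk ↦ ?_⟩
    rw [cs.root_inv_mul_nonneg_iff hM hu, h1]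
    rcases (ha.1 k hk).lt_or_eq with h | h
    · exact Or.inl h
    · exact Or.inr ⟨h.symm, ha.2 k ⟨hk, h.symm⟩⟩

/-- A family of vectors that contains the `m`-th fundamental weight, is stable under the simple
reflections and in which every vector is reachable is the orbit of the fundamental weight. -/
theorem range_weightRow_eq (r : B → ι → ι) (a₀ : ι) (h₀ : q a₀ = Pi.single m 1)
    (hr : ∀ i a k, q (r i a) k = q a k - M.cartanEntry i k * q a i)
    (hreach : ∀ P : ι → Prop, P a₀ → (∀ i a, P a → P (r i a)) → ∀ a, P a) :
    Set.range (cs.weightRow hM m) = Set.range q := by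
  apply subset_antisymm
  · rintro _ ⟨w, rfl⟩
    induction w using cs.simple_induction_right with
    | one => exact ⟨a₀, by rw [h₀, weightRow_one]⟩
    | mul_simple_right w i ih =>
      obtain ⟨a, ha⟩ := ih
      refine ⟨r i a, funext fun k ↦ ?_⟩
      rw [hr, weightRow_mul_simple, ha]
  · rintro _ ⟨a, rfl⟩
    refine hreach (fun a ↦ q a ∈ Set.range (cs.weightRow hM m)) ⟨1, ?_⟩ ?_ a
    · rw [h₀, weightRow_one]
    · rintro i a ⟨w, hw⟩
      refine ⟨w * cs.simple i, funext fun k ↦ ?_⟩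
      rw [hr, weightRow_mul_simple, hw]

end CoxeterSystem

end WeightOrbit

/-! ### Newton expansions and algebras with one generator. -/

section NewtonExpansion

open Polynomial

/-- The remaining quotient is split repeatedly into its value at the next node and a multiple of X -
c_n. The nodes may coincide. -/
theorem Polynomial.exists_newton_expansion {F : Type*} [Field F] (c : ℕ → F) (f : F[X]) (n : ℕ) :
    ∃ (d : ℕ → F) (g : F[X]),
      f = ∑ t ∈ Finset.range n, C (d t) * ∏ i ∈ Finset.range t, (X - C (c i)) +
        g * ∏ i ∈ Finset.range n, (X - C (c i)) := by
  induction n with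
  | zero => exact ⟨0, f, by simp⟩
  | succ n ih =>
    obtain ⟨d, g, hf⟩ := ih
    obtain ⟨g', hg'⟩ := X_sub_C_dvd_sub_C_eval (a := c n) (p := g)
    refine ⟨Function.update d n (g.eval (c n)), g', ?_⟩
    rw [Finset.sum_range_succ, Finset.prod_range_succ, Function.update_self,
      Finset.sum_congr rfl (g := fun t ↦ C (d t) * ∏ i ∈ Finset.range t, (X - C (c i)))]
    · have hg := sub_eq_iff_eq_add.1 hg'
      generalize g.eval (c n) = e at hg
      rw [hf, hg]
      ring
    · intro t ht
      rw [Function.update_of_ne (Finset.mem_range.1 ht).ne]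

variable {F A : Type*} [Field F] [Ring A] [Algebra F A]

/-- A sequence `b 0 = 1, …, b (n - 1)` of linearly independent elements such that `a - c t` takes
`b t` to `b (t + 1)`, and the last one to `0`. -/
structure IsNewtonChain (a : A) (c : ℕ → F) (n : ℕ) (b : ℕ → A) : Prop where
  zero : b 0 = 1
  succ : ∀ t, t + 1 < n → a * b t = c t • b t + b (t + 1)
  last : ∀ t, t + 1 = n → a * b t = c t • b t
  eq_zero : ∀ d : ℕ → F, ∑ t ∈ Finset.range n, d t • b t = 0 → ∀ t < n, d t = 0

namespace IsNewtonChain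

variable {a : A} {c : ℕ → F} {n : ℕ} {b : ℕ → A}

theorem aeval_prod (h : IsNewtonChain a c n b) (t : ℕ) (ht : t < n) :
    aeval a (∏ i ∈ Finset.range t, (X - C (c i))) = b t := by
  induction t with
  | zero => simp [h.zero]
  | succ t ih =>
    rw [Finset.prod_range_succ, mul_comm, map_mul, ih (by omega), map_sub, aeval_X, aeval_C,
      sub_mul, h.succ t ht, ← Algebra.smul_def, add_sub_cancel_left]

theorem aeval_prod_self (h : IsNewtonChain a c n b) (hn : 0 < n) :
    aeval a (∏ i ∈ Finset.range n, (X - C (c i))) = 0 := by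
  obtain ⟨t, rfl⟩ : ∃ t, n = t + 1 := ⟨n - 1, by omega⟩
  rw [Finset.prod_range_succ, mul_comm, map_mul, h.aeval_prod t (by omega), map_sub, aeval_X,
    aeval_C, sub_mul, h.last t rfl, ← Algebra.smul_def, sub_self]

/-- The Newton coefficients of f are the coordinates of f(a) in the basis b. Hence the annihilator
of a depends on c and n alone. -/
theorem aeval_newton_eq_zero_iff (h : IsNewtonChain a c n b) (hn : 0 < n) (d : ℕ → F) (g : F[X]) :
    aeval a (∑ t ∈ Finset.range n, C (d t) * ∏ i ∈ Finset.range t, (X - C (c i)) +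
        g * ∏ i ∈ Finset.range n, (X - C (c i))) = 0 ↔ ∀ t < n, d t = 0 := by
  have key : aeval a (∑ t ∈ Finset.range n, C (d t) * ∏ i ∈ Finset.range t, (X - C (c i)) +
      g * ∏ i ∈ Finset.range n, (X - C (c i))) = ∑ t ∈ Finset.range n, d t • b t := by
    rw [map_add, map_mul, h.aeval_prod_self hn, mul_zero, add_zero, map_sum]
    refine Finset.sum_congr rfl fun t ht ↦ ?_
    rw [map_mul, h.aeval_prod t (Finset.mem_range.1 ht), aeval_C, ← Algebra.smul_def]
  rw [key]
  refine ⟨h.eq_zero d, fun hd ↦ Finset.sum_eq_zero fun t ht ↦ ?_⟩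
  rw [hd t (Finset.mem_range.1 ht), zero_smul]

theorem mem_adjoin (h : IsNewtonChain a c n b) (t : ℕ) (ht : t < n) :
    b t ∈ Algebra.adjoin F {a} := by
  rw [← h.aeval_prod t ht]
  exact aeval_mem_adjoin_singleton F a

end IsNewtonChain

/-- The isomorphism between two algebras generated by one element with the same annihilating
polynomials. -/
theorem exists_algEquiv_adjoin_of_aeval {A' : Type*} [Ring A'] [Algebra F A'] {a : A} {a' : A'}
    (h : ∀ f : F[X], aeval a f = 0 ↔ aeval a' f = 0) :
    ∃ φ : Algebra.adjoin F {a} ≃ₐ[F] Algebra.adjoin F {a'}, ∀ f : F[X],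
      φ ⟨aeval a f, aeval_mem_adjoin_singleton F a⟩ =
        ⟨aeval a' f, aeval_mem_adjoin_singleton F a'⟩ := by
  have hker : RingHom.ker (aeval (R := F) a) = RingHom.ker (aeval (R := F) a') :=
    Ideal.ext h
  let e₁ := Ideal.quotientKerEquivRange (aeval (R := F) a)
  let e₂ := Ideal.quotientKerEquivRange (aeval (R := F) a')
  let φ₀ := e₁.symm.trans ((Ideal.quotientEquivAlgOfEq F hker).trans e₂)
  have hφ₀ : ∀ f : F[X], φ₀ ⟨aeval a f, f, rfl⟩ = ⟨aeval a' f, f, rfl⟩ := by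
    intro f
    have : e₁.symm ⟨aeval a f, f, rfl⟩ = Ideal.Quotient.mk _ f := by
      rw [AlgEquiv.symm_apply_eq]; rfl
    simp only [φ₀, AlgEquiv.trans_apply, this]
    rfl
  refine ⟨(Subalgebra.equivOfEq _ _ (Algebra.adjoin_singleton_eq_range_aeval F a)).trans
    (φ₀.trans (Subalgebra.equivOfEq _ _ (Algebra.adjoin_singleton_eq_range_aeval F a').symm)),
    fun f ↦ ?_⟩
  simp only [AlgEquiv.trans_apply, Subalgebra.equivOfEq_apply, hφ₀]

theorem IsNewtonChain.exists_algEquiv {A' : Type*} [Ring A'] [Algebra F A'] {a : A} {a' : A'}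
    {c : ℕ → F} {n : ℕ} {b : ℕ → A} {b' : ℕ → A'} (hn : 0 < n) (h : IsNewtonChain a c n b)
    (h' : IsNewtonChain a' c n b') :
    ∃ φ : Algebra.adjoin F {a} ≃ₐ[F] Algebra.adjoin F {a'}, ∀ (t : ℕ) (ht : t < n),
      φ ⟨b t, h.mem_adjoin t ht⟩ = ⟨b' t, h'.mem_adjoin t ht⟩ := by
  have haeval : ∀ f : F[X], aeval a f = 0 ↔ aeval a' f = 0 := by
    intro f
    obtain ⟨d, g, hf⟩ := exists_newton_expansion c f n
    rw [hf, h.aeval_newton_eq_zero_iff hn, h'.aeval_newton_eq_zero_iff hn]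
  obtain ⟨φ, hφ⟩ := exists_algEquiv_adjoin_of_aeval haeval
  refine ⟨φ, fun t ht ↦ ?_⟩
  have h1 := hφ (∏ i ∈ Finset.range t, (X - C (c i)))
  simp only [h.aeval_prod t ht, h'.aeval_prod t ht] at h1
  exact h1

end NewtonExpansion

/-! ### Linear independence by test elements. -/

section Independence

theorem MonoidAlgebra.eq_zero_of_sum_smul_eq_zero {F G : Type*} [Field F] [Monoid G] {n : ℕ}
    {b : ℕ → MonoidAlgebra F G} {r : ℕ → F} (hr : ∀ s, r s ≠ 0)
    (hb : ∀ t < n, ∃ w : G, ∀ s < n, (b s).coeff w = if t ≤ s then r s else 0)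
    (d : ℕ → F) (hd : ∑ t ∈ Finset.range n, d t • b t = 0) : ∀ t < n, d t = 0 := by
  -- The coefficient at the t-th test element is a tail sum; consecutive tails differ by one term.
  -- The empty tail t = n serves the last index.
  have htail : ∀ t ≤ n, ∑ s ∈ Finset.range n, (if t ≤ s then d s * r s else 0) = 0 := by
    intro t ht
    rcases ht.lt_or_eq with ht | rfl
    · obtain ⟨w, hw⟩ := hb t ht
      have h1 := congrArg (fun x ↦ x.coeff w) hd
      simp only [MonoidAlgebra.coeff_sum, Finsupp.finsetSum_apply, MonoidAlgebra.coeff_smul,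
        Finsupp.smul_apply, smul_eq_mul] at h1
      refine Eq.trans (Finset.sum_congr rfl fun s hs ↦ ?_) h1
      rw [hw s (Finset.mem_range.1 hs), mul_ite, mul_zero]
    · exact Finset.sum_eq_zero fun s hs ↦ if_neg (not_le.2 (Finset.mem_range.1 hs))
  intro t ht
  have h1 := htail t ht.le
  have h2 := htail (t + 1) ht
  have h3 : ∑ s ∈ Finset.range n, (if s = t then d s * r s else 0) = 0 := by
    refine Eq.trans ?_ ((congrArg₂ (· - ·) h1 h2).trans (sub_zero 0))
    rw [← Finset.sum_sub_distrib]
    refine Finset.sum_congr rfl fun s _ ↦ ?_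
    grind
  rw [Finset.sum_ite_eq' , if_pos (Finset.mem_range.2 ht)] at h3
  exact (mul_eq_zero.1 h3).resolve_right (hr t)

end Independence

section Descent

variable {B : Type*} {M : CoxeterMatrix B} {W : Type*} [Group W]

theorem CoxeterSystem.minCosetReps_univ (cs : CoxeterSystem M W) :
    minCosetReps cs Set.univ = {1} := by
  ext w
  simp only [Set.mem_singleton_iff]
  refine ⟨fun h ↦ ?_, ?_⟩
  · by_contra hw
    obtain ⟨i, hi⟩ := cs.exists_rightDescent_of_ne_one hw
    exact lt_asymm hi (h i trivial)
  · rintro rfl i _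
    simp

theorem CoxeterSystem.descentElement_univ (cs : CoxeterSystem M W) :
    descentElement cs Set.univ = 1 := by
  rw [descentElement, cs.minCosetReps_univ, finsum_mem_singleton, map_one]

theorem CoxeterSystem.one_mem_minCosetReps (cs : CoxeterSystem M W) (K : Set B) :
    1 ∈ minCosetReps cs K := fun i _ ↦ by simp

/-- Simple reflections are the test elements for independence. -/
theorem CoxeterSystem.simple_mem_minCosetReps_iff [Fintype B] [DecidableEq B]
    (cs : CoxeterSystem M W) (hM : M.IsSimplyLaced) (K : Set B) (i : B) :
    cs.simple i ∈ minCosetReps cs K ↔ i ∉ K := by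
  refine ⟨fun h hi ↦ ?_, fun h ↦ (cs.mem_minCosetReps_iff hM).2 fun k hk ↦ ?_⟩
  · have := h i hi
    simp at this
  · have hik : i ≠ k := by rintro rfl; exact h hk
    rw [← one_mul (cs.simple i), root_mul_simple]
    have h1 : ∀ j, 0 ≤ cs.root hM 1 j := fun j ↦ by
      rw [root, map_one, Module.End.one_apply]
      exact Pi.single_nonneg.2 zero_le_one
    refine sub_nonneg_of_le ((smul_nonpos_of_nonpos_of_nonneg ?_ (h1 i)).trans (h1 k))
    rw [CoxeterMatrix.cartanEntry, if_neg hik]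
    split_ifs <;> simp

end Descent

theorem initialSegment_pred_eq_compl {n : ℕ} (hn : 0 < n) :
    initialSegment n (n - 1) = {(⟨n - 1, by omega⟩ : Fin n)}ᶜ := by
  ext i
  simp only [initialSegment, Set.mem_ofPred_eq, Set.mem_compl_iff, Set.mem_singleton_iff,
    Fin.ext_iff]
  omega

theorem initialSegment_self (n : ℕ) : initialSegment n n = Set.univ := by
  ext i
  simp [initialSegment]

/-! ### Type A. -/

section TypeA

variable {r : ℕ}

theorem CoxeterMatrix.A_isSimplyLaced (r : ℕ) : (CoxeterMatrix.A r).IsSimplyLaced := by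
  intro i j hij
  simp only [CoxeterMatrix.A, Matrix.of_apply]
  grind

/-- The values on the simple roots of the weight `ε_a` in type `A_r`. -/
def weightA (r : ℕ) (a : Fin (r + 1)) (k : Fin r) : ℤ :=
  if (a : ℕ) = k + 1 then 1 else if (a : ℕ) = k then -1 else 0

theorem weightA_injective : Function.Injective (weightA r) := by
  intro a b h
  by_contra hab
  wlog hlt : (a : ℕ) < b generalizing a b
  · exact this h.symm (Ne.symm hab) (by rw [Fin.ext_iff] at hab; omega)
  -- With α_k = ε_{k+1} - ε_k, the weight ε_a is -1 on α_a, whereas ε_b with b > a is 0 or 1 there.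
  have h1 := congrFun h ⟨a, by omega⟩
  simp only [weightA] at h1
  grind

theorem eq_zero_of_sum_weightA_eq_zero (v : Fin r → ℤ)
    (hv : ∀ a, ∑ k, v k * weightA r a k = 0) : v = 0 := by
  have key : ∀ d : ℕ, ∀ k : Fin r, (k : ℕ) + d + 1 = r → v k = 0 := by
    intro d
    induction d with
    | zero =>
      intro k hk
      have h1 := hv ⟨r, by omega⟩
      rw [Finset.sum_eq_single k] at h1
      · simpa [weightA, show r = (k : ℕ) + 1 by omega] using h1
      · intro j _ hj
        rw [Ne, Fin.ext_iff] at hj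
        simp only [weightA]
        rw [if_neg (by omega), if_neg (by omega), mul_zero]
      · simp
    | succ d ih =>
      intro k hk
      have h0 := ih ⟨k + 1, by omega⟩ (by simp only; omega)
      have h1 := hv ⟨k + 1, by omega⟩
      rw [Finset.sum_eq_single k] at h1
      · simpa [weightA] using h1
      · intro j _ hj
        rw [Ne, Fin.ext_iff] at hj
        by_cases hj' : j = ⟨k + 1, by omega⟩
        · rw [hj', h0, zero_mul]
        · rw [Fin.ext_iff] at hj'
          simp only [weightA]
          simp only at hj'
          rw [if_neg (by omega), if_neg (by omega), mul_zero]
      · simp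
  ext k
  exact key (r - 1 - k) k (by omega)

variable {W : Type*} [Group W] (cs : CoxeterSystem (CoxeterMatrix.A r) W)

theorem range_weightRow_A (hr : 0 < r) :
    Set.range (cs.weightRow (CoxeterMatrix.A_isSimplyLaced r) ⟨r - 1, by omega⟩) =
      Set.range (weightA r) := by
  refine cs.range_weightRow_eq _
    -- The reflection s_i exchanges ε_i and ε_{i+1}; the last fundamental weight is ε_r.
    (fun i a ↦ if (a : ℕ) = i then ⟨i + 1, by omega⟩ else
      if (a : ℕ) = i + 1 then ⟨i, by omega⟩ else a) (Fin.last r) ?_ ?_ ?_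
  · ext k
    simp only [weightA, Fin.val_last, Pi.single_apply, Fin.ext_iff]
    grind
  · intro i a k
    simp only [weightA, CoxeterMatrix.cartanEntry, CoxeterMatrix.A, Matrix.of_apply, Fin.ext_iff]
    grind
  · intro P h0 hP a
    induction a using Fin.reverseInduction with
    | last => exact h0
    | cast i ih =>
      have := hP i _ ih
      rwa [if_neg (by simp), if_pos (by simp)] at this

theorem finite_of_type_A (cs : CoxeterSystem (CoxeterMatrix.A r) W) (hr : 0 < r) : Finite W :=
  cs.finite_of_range_weightRow_eq _ (range_weightRow_A cs hr) eq_zero_of_sum_weightA_eq_zero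

theorem xA_mul_xA_zero (hr : 0 < r) :
    xA cs (r - 1) * xA cs 0 = ((r : ℚ) + 1) • xA cs 0 := by
  have := finite_of_type_A cs hr
  have hK : initialSegment r 0 = ∅ := by ext; simp [initialSegment]
  rw [xA, xA, initialSegment_pred_eq_compl hr,
    hK,
    cs.descentElement_mul_descentElement _ weightA_injective (range_weightRow_A cs hr)
      (s := Finset.univ) (by simp)]
  simp [← Nat.cast_smul_eq_nsmul ℚ]

/-- The weights nonnegative on α_0, …, α_{j-1} are the ε_a with a ≥ j. For a > j they vanish on all
these roots and give r - j copies of x_j; ε_j is nonzero only on α_{j-1} and gives x_{j-1}. -/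
theorem xA_mul_xA (hr : 0 < r) (j : ℕ) (hj : 1 ≤ j) (hjr : j ≤ r) :
    xA cs (r - 1) * xA cs j = ((r : ℚ) - j) • xA cs j + xA cs (j - 1) := by
  have := finite_of_type_A cs hr
  have hmem : ∀ a, a ∈ insert (⟨j, by omega⟩ : Fin (r + 1)) (Finset.Ioi ⟨j, by omega⟩) ↔
      ∀ k ∈ initialSegment r j, 0 ≤ weightA r a k := by
    intro a
    simp only [Finset.mem_insert, Finset.mem_Ioi, initialSegment, Set.mem_ofPred_eq, Fin.ext_iff,
      Fin.lt_def, weightA]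
    constructor
    · intro h k hk
      grind
    · intro h
      by_contra hlt
      have h1 := h ⟨a, by omega⟩ (by simp only; omega)
      grind
  rw [xA, xA, initialSegment_pred_eq_compl hr, cs.descentElement_mul_descentElement _
    weightA_injective (range_weightRow_A cs hr) hmem, Finset.sum_insert (by simp), Finset.sum_congr rfl (g := fun _ ↦ xA cs j),
    Finset.sum_const, Fin.card_Ioi, add_comm]
  · congr 1
    · rw [← Nat.cast_smul_eq_nsmul ℚ]
      congr 1
      simp only
      rw [Nat.add_sub_cancel, Nat.cast_sub hjr]
    · rw [xA]
      congr 1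
      ext k
      simp only [initialSegment, Set.mem_ofPred_eq, weightA]
      grind
  · intro a ha
    rw [Finset.mem_Ioi, Fin.lt_def] at ha
    rw [xA]
    congr 1
    ext k
    simp only [initialSegment, Set.mem_ofPred_eq, weightA]
    grind

theorem isNewtonChain_A {n : ℕ} (hn : 2 ≤ n) (cs : CoxeterSystem (CoxeterMatrix.A (n - 1)) W) :
    IsNewtonChain ((2 : ℚ) • xA cs (n - 1 - 1))
      (fun t ↦ if t + 1 < n then 2 * (t : ℚ) else 2 * n) n
      (fun t ↦ (2 : ℚ) ^ t • xA cs (n - 1 - t)) where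
  zero := by
    rw [pow_zero, one_smul, Nat.sub_zero, xA, initialSegment_self, cs.descentElement_univ]
  succ t ht := by
    rw [if_pos ht, smul_mul_smul_comm, xA_mul_xA cs (by omega) _ (by omega) (by omega),
      show n - 1 - (t + 1) = n - 1 - t - 1 by omega, Nat.cast_sub (show t ≤ n - 1 by omega)]
    module
  -- The last node is 2n, not 2(n-1): all n weights contribute to the product with x_∅.
  last t ht := by
    rw [if_neg (by omega), smul_mul_smul_comm, show n - 1 - t = 0 by omega,
      xA_mul_xA_zero cs (by omega), Nat.cast_sub (by omega)]
    module
  eq_zero := by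
    have := finite_of_type_A cs (by omega)
    refine MonoidAlgebra.eq_zero_of_sum_smul_eq_zero (r := fun t ↦ (2 : ℚ) ^ t)
      (fun s ↦ by positivity) fun t ht ↦ ?_
    -- The identity lies in every X_K and tests the full sum; for t ≥ 1 the generator of index n-1-t
    -- is missing from the s-th segment exactly when t ≤ s.
    by_cases h0 : t = 0
    · refine ⟨1, fun s hs ↦ ?_⟩
      rw [MonoidAlgebra.coeff_smul, Finsupp.smul_apply, xA, coeff_descentElement,
        if_pos (cs.one_mem_minCosetReps _), if_pos (by omega), smul_eq_mul, mul_one]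
    · refine ⟨cs.simple ⟨n - 1 - t, by omega⟩, fun s hs ↦ ?_⟩
      rw [MonoidAlgebra.coeff_smul, Finsupp.smul_apply, xA, coeff_descentElement]
      simp only [cs.simple_mem_minCosetReps_iff (CoxeterMatrix.A_isSimplyLaced _), initialSegment,
        Set.mem_ofPred_eq, not_lt, smul_eq_mul, mul_ite, mul_one, mul_zero]
      congr 1
      rw [eq_iff_iff]
      omega

end TypeA

/-! ### Type D. -/

section TypeD

variable {n : ℕ}

theorem coxeterMatrixD_isSimplyLaced (n : ℕ) : (coxeterMatrixD n).IsSimplyLaced := by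
  intro i j hij
  simp only [coxeterMatrixD, Matrix.of_apply]
  grind

/-- The values on the simple roots of the weight `ε_a` in type `D_n`. -/
def weightD (a k : ℕ) : ℤ :=
  if k = 0 then (if a = 0 ∨ a = 1 then 1 else 0)
  else if a = k then 1 else if a + 1 = k then -1 else 0

/-- The values on the simple roots of the weights `ε_a` and `-ε_a` in type `D_n`. -/
def signedWeightD (n : ℕ) (p : Fin n × Bool) (k : Fin n) : ℤ :=
  if p.2 then weightD p.1 k else -weightD p.1 k

theorem signedWeightD_injective (hn : 3 ≤ n) : Function.Injective (signedWeightD n) := by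
  have key : ∀ (a b : Fin n) (x y : Bool), (a : ℕ) ≤ b →
      signedWeightD n (a, x) = signedWeightD n (b, y) → (a, x) = (b, y) := by
    intro a b x y hab h
    have h0 := congrFun h ⟨0, by omega⟩
    have h1 := congrFun h ⟨1, by omega⟩
    have h2 := congrFun h a
    have h3 := congrFun h b
    have h4 : ∀ hb : (a : ℕ) + 1 < n, _ := fun hb ↦ congrFun h ⟨a + 1, hb⟩
    simp only [signedWeightD, weightD] at h0 h1 h2 h3 h4
    rw [Prod.mk.injEq, Fin.ext_iff]
    cases x <;> cases y <;> grind
  rintro ⟨a, x⟩ ⟨b, y⟩ h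
  rcases le_total (a : ℕ) b with hab | hab
  · exact key a b x y hab h
  · exact (key b a y x hab h.symm).symm

theorem eq_zero_of_sum_signedWeightD_eq_zero (hn : 3 ≤ n) (v : Fin n → ℤ)
    (hv : ∀ p, ∑ k, v k * signedWeightD n p k = 0) : v = 0 := by
  have key : ∀ d : ℕ, ∀ k : Fin n, (k : ℕ) + d + 1 = n → 2 ≤ (k : ℕ) → v k = 0 := by
    intro d
    induction d with
    | zero =>
      intro k hk hk2
      have h1 := hv (k, true)
      rw [Finset.sum_eq_single k] at h1
      · have hk0 : (k : ℕ) ≠ 0 := by omega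
        simpa [signedWeightD, weightD, hk0] using h1
      · intro j _ hj
        rw [Ne, Fin.ext_iff] at hj
        have : signedWeightD n (k, true) j = 0 := by
          simp only [signedWeightD, weightD]
          grind
        rw [this, mul_zero]
      · simp
    | succ d ih =>
      intro k hk hk2
      have h0 := ih ⟨k + 1, by omega⟩ (by simp only; omega) (by simp only; omega)
      have h1 := hv (k, true)
      rw [Finset.sum_eq_single k] at h1
      · have hk0 : (k : ℕ) ≠ 0 := by omega
        simpa [signedWeightD, weightD, hk0] using h1
      · intro j _ hj
        by_cases hj' : j = ⟨k + 1, by omega⟩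
        · rw [hj', h0, zero_mul]
        · rw [Ne, Fin.ext_iff] at hj
          rw [Fin.ext_iff] at hj'
          simp only at hj'
          have : signedWeightD n (k, true) j = 0 := by
            simp only [signedWeightD, weightD]
            grind
          rw [this, mul_zero]
      · simp
  have key2 : ∀ k : Fin n, 2 ≤ (k : ℕ) → v k = 0 := fun k hk ↦
    key (n - 1 - k) k (by omega) hk
  -- Only α_0 = ε_0 + ε_1 and α_1 = ε_1 - ε_0 remain; testing with ε_0 and ε_1 gives v_0 - v_1 = 0
  -- and v_0 + v_1 = 0.
  have hsum : ∀ p, v ⟨0, by omega⟩ * signedWeightD n p ⟨0, by omega⟩ +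
      v ⟨1, by omega⟩ * signedWeightD n p ⟨1, by omega⟩ = 0 := by
    intro p
    rw [← hv p]
    symm
    refine Finset.sum_eq_add (⟨0, by omega⟩ : Fin n) ⟨1, by omega⟩ (by simp [Fin.ext_iff]) ?_
      (fun h ↦ absurd (Finset.mem_univ _) h) (fun h ↦ absurd (Finset.mem_univ _) h)
    intro k _ hk
    rw [Ne, Ne, Fin.ext_iff, Fin.ext_iff] at hk
    simp only at hk
    rw [key2 k (by omega), zero_mul]
  have h0 := hsum (⟨0, by omega⟩, true)
  have h1 := hsum (⟨1, by omega⟩, true)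
  simp only [signedWeightD, weightD] at h0 h1
  norm_num at h0 h1
  ext k
  by_cases hk : 2 ≤ (k : ℕ)
  · exact key2 k hk
  · obtain hk' | hk' : k = ⟨0, by omega⟩ ∨ k = ⟨1, by omega⟩ := by
      simp only [Fin.ext_iff]; omega
    · rw [hk', Pi.zero_apply]; omega
    · rw [hk', Pi.zero_apply]; omega

/-- The action of the simple reflections of type `D_n` on the signed coordinates. -/
def reflectD (hn : 3 ≤ n) (i : Fin n) (p : Fin n × Bool) : Fin n × Bool :=
  if (i : ℕ) = 0 then
    if (p.1 : ℕ) = 0 then (⟨1, by omega⟩, !p.2)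
    else if (p.1 : ℕ) = 1 then (⟨0, by omega⟩, !p.2) else p
  else
    if (p.1 : ℕ) = i then (⟨i - 1, by omega⟩, p.2)
    else if (p.1 : ℕ) + 1 = i then (i, p.2) else p

theorem signedWeightD_reflectD (hn : 3 ≤ n) (i : Fin n) (p : Fin n × Bool) (k : Fin n) :
    signedWeightD n (reflectD hn i p) k =
      signedWeightD n p k - (coxeterMatrixD n).cartanEntry i k * signedWeightD n p i := by
  obtain ⟨a, x⟩ := p
  simp only [CoxeterMatrix.cartanEntry, coxeterMatrixD, Matrix.of_apply, Fin.ext_iff, reflectD]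
  by_cases hi : (i : ℕ) = 0
  · by_cases h0 : (a : ℕ) = 0
    · cases x <;> simp [signedWeightD, weightD, hi, h0] <;> grind
    · by_cases h1 : (a : ℕ) = 1
      · cases x <;> simp [signedWeightD, weightD, hi, h1] <;> grind
      · cases x <;> simp [signedWeightD, weightD, hi, h0, h1]
  · by_cases h0 : (a : ℕ) = i
    · cases x <;> simp [signedWeightD, weightD, hi, h0] <;> grind
    · by_cases h1 : (a : ℕ) + 1 = i
      · cases x <;> simp [signedWeightD, weightD, hi, h0, h1] <;> grind
      · cases x <;> simp [signedWeightD, weightD, hi, h0, h1]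

/-- From ε_{n-1} the indices descend to ε_0; the reflection in ε_0 + ε_1 sends ε_1 to -ε_0, from
which the negative weights are climbed. -/
theorem reflectD_reachable (hn : 3 ≤ n) (P : Fin n × Bool → Prop) (h : P (⟨n - 1, by omega⟩, true))
    (hP : ∀ i p, P p → P (reflectD hn i p)) (p : Fin n × Bool) : P p := by
  have hpos : ∀ d : ℕ, ∀ a : Fin n, (a : ℕ) + d + 1 = n → P (a, true) := by
    intro d
    induction d with
    | zero =>
      intro a ha
      convert h using 3
      omega
    | succ d ih =>
      intro a ha
      have h1 := hP ⟨a + 1, by omega⟩ _ (ih ⟨a + 1, by omega⟩ (by simp only; omega))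
      simpa [reflectD] using h1
  have hneg : ∀ d : ℕ, ∀ hd : d < n, P (⟨d, hd⟩, false) := by
    intro d
    induction d with
    | zero =>
      intro _
      have h1 := hP ⟨0, by omega⟩ _ (hpos (n - 2) ⟨1, by omega⟩ (by simp only; omega))
      simpa [reflectD] using h1
    | succ d ih =>
      intro hd
      have h1 := hP ⟨d + 1, hd⟩ _ (ih (by omega))
      simpa [reflectD] using h1
  obtain ⟨a, x⟩ := p
  cases x
  · exact hneg a a.2
  · exact hpos (n - 1 - a) a (by omega)

variable {W : Type*} [Group W] (cs : CoxeterSystem (coxeterMatrixD n) W)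

theorem range_weightRow_D (hn : 3 ≤ n) :
    Set.range (cs.weightRow (coxeterMatrixD_isSimplyLaced n) ⟨n - 1, by omega⟩) =
      Set.range (signedWeightD n) := by
  refine cs.range_weightRow_eq _ (reflectD hn) (⟨n - 1, by omega⟩, true) ?_
    (signedWeightD_reflectD hn) (reflectD_reachable hn)
  ext k
  simp only [signedWeightD, weightD, Pi.single_apply, Fin.ext_iff]
  grind

theorem finite_of_type_D (cs : CoxeterSystem (coxeterMatrixD n) W) (hn : 3 ≤ n) : Finite W :=
  cs.finite_of_range_weightRow_eq _ (range_weightRow_D cs hn)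
    (eq_zero_of_sum_signedWeightD_eq_zero hn)

/-- The set of simple reflections that defines `xD cs j`. -/
def segmentD (n j : ℕ) : Set (Fin n) := {i | 2 ≤ j ∧ (i : ℕ) < j}

theorem xD_eq (j : ℕ) : xD cs j = descentElement cs (segmentD n j) := by
  rw [xD]
  split_ifs with h
  · congr 1
    ext i
    simp only [segmentD, Set.mem_ofPred_eq]
    exact iff_of_false id (by omega)
  · congr 1
    ext i
    simp only [segmentD, initialSegment, Set.mem_ofPred_eq]
    omega

theorem segmentD_pred_eq_compl (hn : 3 ≤ n) :
    segmentD n (n - 1) = {(⟨n - 1, by omega⟩ : Fin n)}ᶜ := by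
  rw [← initialSegment_pred_eq_compl (by omega)]
  ext i
  simp only [segmentD, initialSegment, Set.mem_ofPred_eq]
  omega

theorem xD_mul_xD_one (hn : 3 ≤ n) :
    xD cs (n - 1) * xD cs 1 = (2 * (n : ℚ)) • xD cs 1 := by
  have := finite_of_type_D cs hn
  have hK : segmentD n 1 = ∅ := by ext; simp [segmentD]
  rw [xD_eq, xD_eq, segmentD_pred_eq_compl hn, cs.descentElement_mul_descentElement _
    (signedWeightD_injective hn) (range_weightRow_D cs hn) (s := Finset.univ) (by simp [hK]), hK]
  simp [← Nat.cast_smul_eq_nsmul ℚ, mul_comm]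

/-- The admissible weights are ±ε_a with a ≥ j, which vanish on the whole segment, and ε_{j-1},
which gives x_{j-1}. For j = 2 the weight ε_1 is 1 on both α_0 and α_1, which is why x_1 is x_∅. -/
theorem xD_mul_xD (hn : 3 ≤ n) (j : ℕ) (hj : 2 ≤ j) (hjn : j ≤ n) :
    xD cs (n - 1) * xD cs j = (2 * ((n : ℚ) - j)) • xD cs j + xD cs (j - 1) := by
  have := finite_of_type_D cs hn
  have hmem : ∀ p, p ∈ insert ((⟨j - 1, by omega⟩ : Fin n), true)
      (Finset.Ioi ⟨j - 1, by omega⟩ ×ˢ Finset.univ) ↔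
      ∀ k ∈ segmentD n j, 0 ≤ signedWeightD n p k := by
    rintro ⟨a, x⟩
    simp only [Finset.mem_univ, and_true, Finset.mem_insert, Finset.mem_product, Finset.mem_Ioi,
      segmentD, Set.mem_ofPred_eq, Fin.ext_iff, Fin.lt_def, Prod.mk.injEq, signedWeightD, weightD]
    constructor
    · intro h k hk
      cases x <;> grind
    · intro h
      have h0 := h ⟨0, by omega⟩ ⟨hj, by simp only; omega⟩
      have h1 := h a
      have h2 : ∀ ha : (a : ℕ) + 1 < n, _ := fun ha ↦ h ⟨a + 1, ha⟩
      simp only at h0 h1 h2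
      cases x <;> grind
  rw [xD_eq, xD_eq, segmentD_pred_eq_compl hn, cs.descentElement_mul_descentElement _
    (signedWeightD_injective hn) (range_weightRow_D cs hn) hmem, Finset.sum_insert (by simp), Finset.sum_congr rfl (g := fun _ ↦ xD cs j),
    Finset.sum_const, Finset.card_product, Fin.card_Ioi, add_comm]
  · congr 1
    · rw [← Nat.cast_smul_eq_nsmul ℚ, xD_eq]
      congr 1
      simp only [Finset.card_univ, Fintype.card_bool]
      rw [show n - 1 - (j - 1) = n - j by omega, Nat.cast_mul, Nat.cast_sub hjn]
      push_cast
      ring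
    · rw [xD_eq]
      congr 1
      ext k
      simp only [segmentD, Set.mem_ofPred_eq, signedWeightD, weightD]
      grind
  · rintro ⟨a, x⟩ ha
    simp only [Finset.mem_product, Finset.mem_Ioi, Fin.lt_def] at ha
    rw [xD_eq]
    congr 1
    ext k
    simp only [segmentD, Set.mem_ofPred_eq, signedWeightD, weightD]
    grind

theorem isNewtonChain_D (hn : 3 ≤ n) :
    IsNewtonChain (xD cs (n - 1)) (fun t ↦ if t + 1 < n then 2 * (t : ℚ) else 2 * n) n
      (fun t ↦ xD cs (n - t)) where
  zero := by
    have : segmentD n n = Set.univ := by ext i; simp [segmentD]; omega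
    rw [Nat.sub_zero, xD_eq, this, cs.descentElement_univ]
  succ t ht := by
    rw [if_pos ht, xD_mul_xD cs hn _ (by omega) (by omega),
      show n - (t + 1) = n - t - 1 by omega, Nat.cast_sub (show t ≤ n by omega), sub_sub_cancel]
  last t ht := by
    rw [if_neg (by omega), show n - t = 1 by omega, xD_mul_xD_one cs hn]
  eq_zero := by
    have := finite_of_type_D cs hn
    refine MonoidAlgebra.eq_zero_of_sum_smul_eq_zero (r := fun _ ↦ (1 : ℚ))
      (fun s ↦ one_ne_zero) fun t ht ↦ ?_
    by_cases h0 : t = 0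
    · refine ⟨1, fun s hs ↦ ?_⟩
      rw [xD_eq, coeff_descentElement, if_pos (cs.one_mem_minCosetReps _), if_pos (by omega)]
    · refine ⟨cs.simple ⟨n - t, by omega⟩, fun s hs ↦ ?_⟩
      rw [xD_eq, coeff_descentElement]
      simp only [cs.simple_mem_minCosetReps_iff (coxeterMatrixD_isSimplyLaced _), segmentD,
        Set.mem_ofPred_eq]
      congr 1
      rw [eq_iff_iff]
      omega

end TypeD

theorem adjoin_singleton_smul {F A : Type*} [Field F] [Ring A] [Algebra F A] {c : F} (hc : c ≠ 0)
    (a : A) : Algebra.adjoin F {c • a} = Algebra.adjoin F {a} := by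
  refine le_antisymm ?_ ?_ <;> rw [Algebra.adjoin_le_iff, Set.singleton_subset_iff]
  · exact Subalgebra.smul_mem _ (Algebra.self_mem_adjoin_singleton F a) c
  · rw [SetLike.mem_coe]
    nth_rewrite 2 [← inv_smul_smul₀ hc a]
    exact Subalgebra.smul_mem _ (Algebra.self_mem_adjoin_singleton F _) _

theorem mainTheorem10 (n : ℕ) (hn : 3 ≤ n) {W W' : Type*} [Group W] [Group W']
    (cs : CoxeterSystem (coxeterMatrixD n) W)
    (cs' : CoxeterSystem (CoxeterMatrix.A (n - 1)) W') :
    ∃ φ : algED cs ≃ₐ[ℚ] algEA cs',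
      ∀ j : ℕ, 1 ≤ j → j ≤ n →
        ∃ (hD : xD cs j ∈ algED cs) (hA : xA cs' (j - 1) ∈ algEA cs'),
          φ ⟨xD cs j, hD⟩ = (2 : ℚ) ^ (n - j) • (⟨xA cs' (j - 1), hA⟩ : algEA cs') := by
  unfold algED algEA
  have hchain := isNewtonChain_D cs hn
  have hchain' := isNewtonChain_A (by omega) cs'
  obtain ⟨φ, hφ⟩ := hchain.exists_algEquiv (by omega) hchain'
  have hadj := adjoin_singleton_smul (two_ne_zero (α := ℚ)) (xA cs' (n - 1 - 1))
  -- The type A chain is generated by twice the element defining `algEA`; both generate the same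
  -- subalgebra.
  refine ⟨φ.trans (Subalgebra.equivOfEq _ _ hadj), fun j hj hjn ↦ ?_⟩
  have hD := hchain.mem_adjoin (n - j) (by omega)
  have hA := hchain'.mem_adjoin (n - j) (by omega)
  have h := hφ (n - j) (by omega)
  have e1 : n - (n - j) = j := by omega
  have e2 : n - 1 - (n - j) = j - 1 := by omega
  simp only [e1, e2] at hD hA h
  rw [hadj] at hA
  have hA' : xA cs' (j - 1) ∈ Algebra.adjoin ℚ {xA cs' (n - 1 - 1)} := by
    rw [← inv_smul_smul₀ (pow_ne_zero (n - j) (two_ne_zero (α := ℚ))) (xA cs' (j - 1))]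
    exact Subalgebra.smul_mem _ hA _
  refine ⟨hD, hA', Subtype.ext ?_⟩
  rw [AlgEquiv.trans_apply, h, Subalgebra.equivOfEq_apply]
  rfl
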